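/- Let $d\ge 2$ and $\Lambda=\{-1,+1\}$. Let $\Omega=\{-1,1\}^{\mathbb N}$ carry its product $\sigma$-algebra, let $(p_n)_{n\ge 0}$ satisfy $0<p_n<1$, put $q_n=1-p_n$, and let $\mathbb P$ be the product probability measure under which the coordinates $\zeta_n$ are independent with $\mathbb P(\zeta_n=1)=p_n$, $\mathbb P(\zeta_n=-1)=q_n$. Let $\mathcal H=L^2(\Omega,\mathbb P;\mathbb C)$, with canonical orthonormal basis $Z_\sigma=\prod_{j\in\sigma}Z_j$ ($\sigma\subset\mathbb N$ finite), where $Z_j=(\zeta_j+q_j-p_j)/(2\sqrt{p_jq_j})$. Let $\partial_n$ be the annihilation operator on $\mathcal H$, i.e. the bounded operator with $\partial_nZ_\sigma=\mathbf 1_\sigma(n)Z_{\sigma\setminus\{n\}}$, and put $$L_n=\tfrac12(\partial_n^*+\partial_n-I),\quad R_n=\tfrac12(\partial_n^*+\partial_n+I),\quad B_n^{(-1)}=L_n,\quad B_n^{(+1)}=R_n .$$ Let $\mathsf K\colon\mathcal H^{\otimes d}\to\mathcal H$ be a unitary isomorphism and, for $n\ge0$ and $\varepsilon\in\Lambda^d$,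 let $C_n^{(\varepsilon)}=\mathsf K\big(\bigotimes_{j=1}^dB_n^{(\varepsilon_j)}\big)\mathsf K^{-1}$. A nucleus is a map $\omega$ from $\mathbb Z^d$ to the positive trace class operators on $\mathcal H$ with $\sum_{x\in\mathbb Z^d}\mathrm{Tr}\,\omega(x)=1$. Let $\omega^{(0)}$ be a nucleus and define the nucleus sequence of the $d$-dimensional open QBN walk by $$\omega^{(n+1)}(x)=\sum_{\varepsilon\in\Lambda^d}C_n^{(\varepsilon)}\,\omega^{(n)}(x-\varepsilon)\,C_n^{(\varepsilon)},\qquad x\in\mathbb Z^d,\ n\ge 0,$$ and its state sequence by $$\widetilde{\omega^{(n)}}=\sum_{x\in\mathbb Z^d}|\delta_x\rangle\langle\delta_x|\otimes\omega^{(n)}(x)\quad\text{on } l^2(\mathbb Z^d)\otimes\mathcal H,$$ the sum being taken in the trace norm, where $(\delta_x)$ is the canonical orthonormal basis of $l^2(\mathbb Z^d)$. For $x,y\in\mathbb Z^d$ let $M^{(n)}_{x,y}=|\delta_x\rangle\langle\delta_y|\otimes C_n^{(x-y)}$ if $x-y\in\Lambda^d$ and $M^{(n)}_{x,y}=0$ otherwise,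 and let $\mathsf M^{(n)}(T)=\sum_{x,y\in\mathbb Z^d}M^{(n)}_{x,y}\,T\,{M^{(n)}_{x,y}}^{*}$ for $T$ of trace class, the sum being taken in the trace norm. Then for every $n\ge 0$: $\omega^{(n)}$ is a nucleus, the series defining $\widetilde{\omega^{(n)}}$ converges in the trace norm and $\widetilde{\omega^{(n)}}$ is a density operator (positive, of trace class, with unit trace); moreover the series defining $\mathsf M^{(n)}\big(\widetilde{\omega^{(n)}}\big)$ converges in the trace norm, and $$\widetilde{\omega^{(n+1)}}=\mathsf M^{(n)}\Big(\widetilde{\omega^{(n)}}\Big).$$ -/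

import Mathlib

open MeasureTheory ProbabilityTheory Filter Topology
open scoped ENNReal TensorProduct InnerProductSpace

noncomputable section

namespace OpenQBN

/-! ### Trace class operators on a complex Hilbert space -/

section TraceClass

variable {E : Type*} [NormedAddCommGroup E] [InnerProductSpace ℂ E] [CompleteSpace E]

variable (E) in
/-- An orthonormal (Hilbert) basis of `E`; it is only used to compute traces, which do not depend
on the basis. -/
def stdBasis : HilbertBasis (exists_hilbertBasis ℂ E).choose ℂ E :=
  (exists_hilbertBasis ℂ E).choose_spec.choose

/-- The trace norm `‖T‖₁ = Tr |T|`, with `|T| = (T* T)^{1/2}`, as an extended nonnegative number.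
(Since `|T|` is positive, `‖⟪e, |T| e⟫‖ₑ` is just the number `⟪e, |T| e⟫`.) -/
def traceNorm (T : E →L[ℂ] E) : ℝ≥0∞ :=
  ∑' i, ‖⟪stdBasis E i, CFC.abs T (stdBasis E i)⟫_ℂ‖ₑ

/-- `T` is of trace class. -/
def IsTraceClass (T : E →L[ℂ] E) : Prop := traceNorm T < ∞

/-- The trace of a trace class operator. -/
def trace (T : E →L[ℂ] E) : ℂ := ∑' i, ⟪stdBasis E i, T (stdBasis E i)⟫_ℂ

/-- A density operator: positive, of trace class, with unit trace. -/
def IsDensity (T : E →L[ℂ] E) : Prop := T.IsPositive ∧ IsTraceClass T ∧ trace T = 1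

/-- The series `∑ i, f i` of trace class operators converges (unconditionally) in the trace norm
to the trace class operator `S`. -/
def HasTraceSum {ι : Type*} (f : ι → E →L[ℂ] E) (S : E →L[ℂ] E) : Prop :=
  (∀ i, IsTraceClass (f i)) ∧ IsTraceClass S ∧
    Tendsto (fun F : Finset ι => traceNorm (S - ∑ i ∈ F, f i)) atTop (𝓝 0)

open Classical in
/-- The sum of a series of trace class operators that converges in the trace norm
(and `0` if the series does not converge). -/
def traceSum {ι : Type*} (f : ι → E →L[ℂ] E) : E →L[ℂ] E :=
  if h : ∃ S, HasTraceSum f S then h.choose else 0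

end TraceClass

/-! ### Hilbert space tensor products -/

/-- The Hilbert space tensor product: the completion of the algebraic tensor product with respect
to the inner product `⟪a ⊗ b, a' ⊗ b'⟫ = ⟪a, a'⟫ ⟪b, b'⟫`. -/
abbrev HTensor (E F : Type*) [NormedAddCommGroup E] [InnerProductSpace ℂ E]
    [NormedAddCommGroup F] [InnerProductSpace ℂ F] : Type _ :=
  UniformSpace.Completion (E ⊗[ℂ] F)

/-- The tensor product `S ⊗ T` of bounded operators, the unique bounded operator with
`(S ⊗ T) (a ⊗ b) = S a ⊗ T b`. -/
def opTensor {E F : Type*} [NormedAddCommGroup E] [InnerProductSpace ℂ E]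
    [NormedAddCommGroup F] [InnerProductSpace ℂ F] (S : E →L[ℂ] E) (T : F →L[ℂ] F) :
    HTensor E F →L[ℂ] HTensor E F :=
  (TensorProduct.mapL S T).completion

/-- A bundled complex Hilbert space. -/
structure HilbertSp where
  carrier : Type
  [group : NormedAddCommGroup carrier]
  [inner : InnerProductSpace ℂ carrier]
  [complete : CompleteSpace carrier]

instance (X : HilbertSp) : NormedAddCommGroup X.carrier := X.group
instance (X : HilbertSp) : InnerProductSpace ℂ X.carrier := X.inner
instance (X : HilbertSp) : CompleteSpace X.carrier := X.complete

section TensorPower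

variable (E : Type) [NormedAddCommGroup E] [InnerProductSpace ℂ E]

/-- The `d`-fold Hilbert space tensor power as a bundled space:
`E^{⊗ 0} = ℂ` and `E^{⊗ (d+1)} = E ⊗ E^{⊗ d}`. -/
def tensorPowerSp : ℕ → HilbertSp
  | 0 => { carrier := ℂ }
  | d + 1 => { carrier := HTensor E (tensorPowerSp d).carrier }

/-- The `d`-fold Hilbert space tensor power `E^{⊗ d}`. -/
abbrev TensorPower (d : ℕ) : Type := (tensorPowerSp E d).carrier

variable {E}

/-- The elementary tensor `v_1 ⊗ ⋯ ⊗ v_d` in `E^{⊗ d}`. -/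
def tensorVec : (d : ℕ) → (Fin d → E) → TensorPower E d
  | 0, _ => (1 : ℂ)
  | d + 1, v =>
    ((v 0 ⊗ₜ[ℂ] tensorVec d (fun j => v j.succ) : E ⊗[ℂ] TensorPower E d) :
      HTensor E (TensorPower E d))

/-- The tensor product `B_1 ⊗ ⋯ ⊗ B_d` of bounded operators on `E`, acting on `E^{⊗ d}`. -/
def tensorPowerOp : (d : ℕ) → (Fin d → (E →L[ℂ] E)) → (TensorPower E d →L[ℂ] TensorPower E d)
  | 0, _ => ContinuousLinearMap.id ℂ ℂ
  | d + 1, B => opTensor (B 0) (tensorPowerOp d (fun j => B j.succ))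

theorem inner_tensorVec (d : ℕ) (v w : Fin d → E) :
    ⟪tensorVec d v, tensorVec d w⟫_ℂ = ∏ j, ⟪v j, w j⟫_ℂ := by
  induction d with
  | zero =>
    change ⟪(1 : ℂ), (1 : ℂ)⟫_ℂ = _
    simp
  | succ d ih =>
    rw [Fin.prod_univ_succ, ← ih]
    exact UniformSpace.Completion.inner_coe _ _

theorem tensorPowerOp_tensorVec (d : ℕ) (B : Fin d → (E →L[ℂ] E)) (v : Fin d → E) :
    tensorPowerOp d B (tensorVec d v) = tensorVec d (fun j => B j (v j)) := by
  induction d with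
  | zero => rfl
  | succ d ih =>
    change opTensor (B 0) (tensorPowerOp d (fun j => B j.succ))
      ((v 0 ⊗ₜ[ℂ] tensorVec d (fun j => v j.succ) : E ⊗[ℂ] TensorPower E d) :
        HTensor E (TensorPower E d)) = _
    rw [opTensor, ContinuousLinearMap.completion_apply_coe, TensorProduct.mapL_tmul, ih]
    rfl

end TensorPower

/-! ### Quantum Bernoulli noises -/

instance : MeasurableSingletonClass ℤˣ where
  measurableSet_singleton e :=
    ⟨{(e : ℤ)}, measurableSet_singleton _, by ext x; simp [Units.ext_iff]⟩

/-- The sample space of all functions `ℕ → {-1, 1}`, with the product σ-algebra. -/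
abbrev Omega : Type := ℕ → ℤˣ

/-- The law on `{-1, 1}` giving mass `p` to `1` and `1 - p` to `-1`. -/
def coin (p : Set.Ioo (0 : ℝ) 1) : Measure ℤˣ :=
  ENNReal.ofReal (p : ℝ) • Measure.dirac 1 + ENNReal.ofReal (1 - p : ℝ) • Measure.dirac (-1)

instance (p : Set.Ioo (0 : ℝ) 1) : IsProbabilityMeasure (coin p) := by
  constructor
  simp only [coin, Measure.add_apply, Measure.smul_apply, measure_univ, smul_eq_mul, mul_one]
  rw [← ENNReal.ofReal_add p.2.1.le (sub_nonneg.2 p.2.2.le)]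
  simp

section Bernoulli

variable (p : ℕ → Set.Ioo (0 : ℝ) 1)

/-- The Bernoulli probability measure: the coordinates are independent, and the `n`-th one is `1`
with probability `p n` and `-1` with probability `1 - p n`. -/
def bernoulli : Measure Omega := Measure.infinitePi (fun n => coin (p n))

instance : IsProbabilityMeasure (bernoulli p) := by
  unfold bernoulli; infer_instance

/-- The space `L²` of square integrable complex-valued Bernoulli functionals. -/
abbrev BernoulliL2 : Type := Lp ℂ 2 (bernoulli p)

/-- `(e + q - p) / (2 √(p q))` with `q = 1 - p`, for `e ∈ {-1, 1}`. -/
def zVal (p : Set.Ioo (0 : ℝ) 1) (e : ℤˣ) : ℝ :=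
  (((e : ℤ) : ℝ) + (1 - p) - p) / (2 * √(p * (1 - p)))

/-- The Bernoulli functional `Z_σ = ∏_{j ∈ σ} Z_j`, with `Z_j = (ζ_j + q_j - p_j) / (2 √(p_j q_j))`
and `ζ_j` the `j`-th coordinate. -/
def zFun (σ : Finset ℕ) (ω : Omega) : ℂ := ∏ j ∈ σ, (zVal (p j) (ω j) : ℂ)

theorem measurable_zFun (σ : Finset ℕ) : Measurable (zFun p σ) := by
  unfold zFun
  refine Finset.measurable_prod _ fun j _ => ?_
  exact (measurable_of_finite (fun e : ℤˣ => (zVal (p j) e : ℂ))).comp (measurable_pi_apply j)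

theorem exists_bound_zFun (σ : Finset ℕ) : ∃ C : ℝ, ∀ ω, ‖zFun p σ ω‖ ≤ C := by
  refine ⟨∏ j ∈ σ, (‖zVal (p j) 1‖ + ‖zVal (p j) (-1)‖), fun ω => ?_⟩
  unfold zFun
  rw [norm_prod]
  refine Finset.prod_le_prod (fun _ _ => norm_nonneg _) fun j _ => ?_
  rw [Complex.norm_real]
  rcases Int.units_eq_one_or (ω j) with h | h <;> rw [h] <;>
    linarith [norm_nonneg (zVal (p j) 1), norm_nonneg (zVal (p j) (-1))]

theorem memLp_zFun (σ : Finset ℕ) (r : ℝ≥0∞) : MemLp (zFun p σ) r (bernoulli p) := by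
  obtain ⟨C, hC⟩ := exists_bound_zFun p σ
  exact MemLp.of_bound (measurable_zFun p σ).aestronglyMeasurable C (Eventually.of_forall hC)

/-- `Z_σ` as an element of `L²`. -/
def zVec (σ : Finset ℕ) : BernoulliL2 p := (memLp_zFun p σ 2).toLp

/-- Multiplication by the bounded function `Z_k`, as a bounded operator on `L²`. -/
def mulZ (k : ℕ) : BernoulliL2 p →L[ℂ] BernoulliL2 p :=
  (ContinuousLinearMap.mul ℂ ℂ).holderL (bernoulli p) ∞ 2 2 (memLp_zFun p {k} ∞).toLp

/-- The σ-algebra generated by all coordinates except the `k`-th one. -/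
abbrev sigmaExcept (k : ℕ) : MeasurableSpace Omega :=
  ⨆ j ∈ ({k}ᶜ : Set ℕ), MeasurableSpace.comap (fun ω : Omega => ω j) inferInstance

theorem sigmaExcept_le (k : ℕ) : sigmaExcept k ≤ (inferInstance : MeasurableSpace Omega) :=
  iSup₂_le fun j _ => (measurable_pi_apply j).comap_le

/-- Conditional expectation on `L²` with respect to all coordinates except the `k`-th one. -/
def condExcept (k : ℕ) : BernoulliL2 p →L[ℂ] BernoulliL2 p :=
  (lpMeas ℂ ℂ (sigmaExcept k) 2 (bernoulli p)).subtypeL ∘L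
    condExpL2 ℂ ℂ (sigmaExcept_le k)

/-- The annihilation operator `∂_k`, as the bounded operator `∂_k ξ = 𝔼[Z_k ξ | (ω_j)_{j ≠ k}]`.
It acts on the canonical orthonormal basis by `∂_k Z_σ = 1_σ(k) Z_{σ \ k}`, and its adjoint by
`∂_k^* Z_σ = (1 - 1_σ(k)) Z_{σ ∪ k}`; see `annihilation_zVec` and `adjoint_annihilation_zVec`. -/
def annihilation (k : ℕ) : BernoulliL2 p →L[ℂ] BernoulliL2 p := condExcept p k ∘L mulZ p k

theorem mulZ_ae (k : ℕ) (ξ : BernoulliL2 p) :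
    mulZ p k ξ =ᵐ[bernoulli p] fun ω => (zVal (p k) (ω k) : ℂ) * ξ ω := by
  have h1 := ContinuousLinearMap.coeFn_holder (r := 2) (ContinuousLinearMap.mul ℂ ℂ)
    (memLp_zFun p {k} ∞).toLp ξ
  have h2 := (memLp_zFun p {k} ∞).coeFn_toLp
  filter_upwards [h1, h2] with ω h1 h2
  change ((ContinuousLinearMap.mul ℂ ℂ).holder 2 (memLp_zFun p {k} ∞).toLp ξ) ω = _
  rw [h1, h2]
  simp [zFun]

theorem integral_coord (k : ℕ) (g : ℤˣ → ℂ) :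
    ∫ ω, g (ω k) ∂(bernoulli p) = (p k : ℝ) * g 1 + (1 - (p k : ℝ) : ℝ) * g (-1) := by
  have h : (bernoulli p).map (fun ω => ω k) = coin (p k) :=
    Measure.infinitePi_map_eval (fun n => coin (p n)) k
  have h' := integral_map (μ := bernoulli p) (φ := fun ω : Omega => ω k) (f := g)
    (measurable_pi_apply k).aemeasurable (measurable_of_finite g).aestronglyMeasurable
  rw [← h', h, coin, integral_add_measure, integral_smul_measure,
    integral_smul_measure, integral_dirac, integral_dirac, ENNReal.toReal_ofReal (p k).2.1.le,
    ENNReal.toReal_ofReal (sub_nonneg.2 (p k).2.2.le)]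
  · simp
  all_goals exact (integrable_dirac (by simp)).smul_measure ENNReal.ofReal_ne_top

theorem indep_coord (k : ℕ) : Indep
    (MeasurableSpace.comap (fun ω : Omega => ω k) inferInstance) (sigmaExcept k) (bernoulli p) := by
  have h : iIndepFun (fun (i : ℕ) (ω : Omega) => ω i) (bernoulli p) :=
    iIndepFun_infinitePi (P := fun n => coin (p n)) (X := fun _ e => e) (fun _ => measurable_id)
  have := indep_iSup_of_disjoint (S := {k}) (T := {k}ᶜ)
    (fun j => (measurable_pi_apply (X := fun _ : ℕ => ℤˣ) j).comap_le) h disjoint_compl_right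
  simpa [sigmaExcept] using this

theorem condExcept_mul (k : ℕ) (τ : Finset ℕ) (hτ : k ∉ τ) (g : ℤˣ → ℂ)
    (ξ : BernoulliL2 p) (hξ : ξ =ᵐ[bernoulli p] fun ω => zFun p τ ω * g (ω k)) :
    condExcept p k ξ = (∫ ω, g (ω k) ∂(bernoulli p)) • zVec p τ := by
  have hle := sigmaExcept_le k
  have hmeas : StronglyMeasurable[sigmaExcept k] (zFun p τ) := by
    have : Measurable[sigmaExcept k] (zFun p τ) := by
      unfold zFun
      refine Finset.measurable_prod _ fun j hj => ?_
      have hj' : Measurable[sigmaExcept k] (fun ω : Omega => ω j) := by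
        rw [measurable_iff_comap_le]
        exact le_iSup₂_of_le j (by rintro rfl; exact hτ hj) le_rfl
      exact (measurable_of_finite (fun e : ℤˣ => (zVal (p j) e : ℂ))).comp hj'
    exact this.stronglyMeasurable
  have hg : MemLp (fun ω : Omega => g (ω k)) 2 (bernoulli p) := by
    refine MemLp.of_bound ((measurable_of_finite g).comp
      (measurable_pi_apply k)).aestronglyMeasurable (‖g 1‖ + ‖g (-1)‖)
      (Eventually.of_forall fun ω => ?_)
    rcases Int.units_eq_one_or (ω k) with h | h <;> rw [h] <;>
      linarith [norm_nonneg (g 1), norm_nonneg (g (-1))]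
  have hprod : Integrable (zFun p τ * fun ω : Omega => g (ω k)) (bernoulli p) :=
    ((Lp.memLp ξ).integrable one_le_two).congr hξ
  have h1 : condExcept p k ξ =ᵐ[bernoulli p] (bernoulli p)[ξ | sigmaExcept k] := by
    have := MemLp.condExpL2_ae_eq_condExp (𝕜 := ℂ) hle (Lp.memLp ξ)
    rw [Lp.toLp_coeFn] at this
    exact this
  have h2 : (bernoulli p)[ξ | sigmaExcept k] =ᵐ[bernoulli p]
      (bernoulli p)[zFun p τ * fun ω => g (ω k) | sigmaExcept k] := condExp_congr_ae hξ
  have h3 := condExp_bilin_of_stronglyMeasurable_left (ContinuousLinearMap.mul ℝ ℂ)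
    (μ := bernoulli p) hmeas hprod (hg.integrable one_le_two)
  have h4 : (bernoulli p)[fun ω => g (ω k) | sigmaExcept k] =ᵐ[bernoulli p]
      fun _ => ∫ ω, g (ω k) ∂(bernoulli p) := by
    refine condExp_indep_eq (measurable_pi_apply k).comap_le hle ?_ (indep_coord p k)
    exact ((measurable_of_finite g).comp (comap_measurable _)).stronglyMeasurable
  refine Lp.ext ?_
  filter_upwards [h1, h2, h3, h4, Lp.coeFn_smul (∫ ω, g (ω k) ∂(bernoulli p)) (zVec p τ),
    (memLp_zFun p τ 2).coeFn_toLp] with ω h1 h2 h3 h4 h5 h6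
  rw [h1, h2]
  refine h3.trans ?_
  rw [h4, h5, Pi.smul_apply, zVec, h6, smul_eq_mul, mul_comm]
  rfl

theorem integral_zVal (k : ℕ) : ∫ ω, (zVal (p k) (ω k) : ℂ) ∂(bernoulli p) = 0 := by
  rw [integral_coord p k (fun e => (zVal (p k) e : ℂ))]
  norm_cast
  simp only [zVal]
  push_cast
  field_simp
  ring

theorem integral_zVal_sq (k : ℕ) :
    ∫ ω, (zVal (p k) (ω k) : ℂ) ^ 2 ∂(bernoulli p) = 1 := by
  rw [integral_coord p k (fun e => (zVal (p k) e : ℂ) ^ 2)]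
  norm_cast
  have h0 := (p k).2.1
  have h1 := (p k).2.2
  simp only [zVal, div_pow, mul_pow]
  rw [Real.sq_sqrt (mul_nonneg h0.le (sub_nonneg.2 h1.le))]
  have h2 : (1 - (p k : ℝ)) ≠ 0 := (sub_pos.2 h1).ne'
  have h3 : (p k : ℝ) ≠ 0 := h0.ne'
  push_cast
  field_simp
  ring

theorem zVec_ae (σ : Finset ℕ) : zVec p σ =ᵐ[bernoulli p] zFun p σ :=
  (memLp_zFun p σ 2).coeFn_toLp

theorem annihilation_zVec (k : ℕ) (σ : Finset ℕ) :
    annihilation p k (zVec p σ) = if k ∈ σ then zVec p (σ.erase k) else 0 := by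
  have h := mulZ_ae p k (zVec p σ)
  rw [annihilation, ContinuousLinearMap.comp_apply]
  split_ifs with hk
  · rw [condExcept_mul p k (σ.erase k) (Finset.notMem_erase k σ)
      (fun e => (zVal (p k) e : ℂ) ^ 2), integral_zVal_sq, one_smul]
    filter_upwards [h, zVec_ae p σ] with ω h h'
    rw [h, h', zFun, zFun, ← Finset.mul_prod_erase σ _ hk]
    ring
  · rw [condExcept_mul p k σ hk (fun e => (zVal (p k) e : ℂ)), integral_zVal, zero_smul]
    filter_upwards [h, zVec_ae p σ] with ω h h'
    rw [h, h', mul_comm]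

theorem adjoint_condExcept (k : ℕ) :
    ContinuousLinearMap.adjoint (condExcept p k) = condExcept p k := by
  refine ((ContinuousLinearMap.eq_adjoint_iff _ _).2 fun x y => ?_).symm
  exact inner_condExpL2_left_eq_right (sigmaExcept_le k)

theorem adjoint_mulZ (k : ℕ) : ContinuousLinearMap.adjoint (mulZ p k) = mulZ p k := by
  refine ((ContinuousLinearMap.eq_adjoint_iff _ _).2 fun x y => ?_).symm
  rw [L2.inner_def, L2.inner_def]
  refine integral_congr_ae ?_
  filter_upwards [mulZ_ae p k x, mulZ_ae p k y] with ω hx hy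
  rw [hx, hy]
  simp only [RCLike.inner_apply, map_mul, Complex.conj_ofReal]
  ring

theorem adjoint_annihilation_zVec (k : ℕ) (σ : Finset ℕ) :
    ContinuousLinearMap.adjoint (annihilation p k) (zVec p σ) =
      if k ∈ σ then 0 else zVec p (insert k σ) := by
  rw [annihilation, ContinuousLinearMap.adjoint_comp, adjoint_condExcept, adjoint_mulZ,
    ContinuousLinearMap.comp_apply]
  split_ifs with hk
  · rw [condExcept_mul p k (σ.erase k) (Finset.notMem_erase k σ)
      (fun e => (zVal (p k) e : ℂ)), integral_zVal, zero_smul, map_zero]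
    filter_upwards [zVec_ae p σ] with ω h'
    rw [h', zFun, zFun, ← Finset.mul_prod_erase σ _ hk, mul_comm]
  · rw [condExcept_mul p k σ hk (fun _ => 1)]
    · simp only [integral_const, probReal_univ, one_smul]
      refine Lp.ext ?_
      filter_upwards [mulZ_ae p k (zVec p σ), zVec_ae p σ, zVec_ae p (insert k σ)]
        with ω h h' h''
      rw [h, h', h'', zFun, zFun, Finset.prod_insert hk]
    · filter_upwards [zVec_ae p σ] with ω h'
      rw [h', mul_one]

/-- `L_n = (∂_n^* + ∂_n - I) / 2`. -/
def opL (n : ℕ) : BernoulliL2 p →L[ℂ] BernoulliL2 p :=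
  (1 / 2 : ℂ) • (ContinuousLinearMap.adjoint (annihilation p n) + annihilation p n - 1)

/-- `R_n = (∂_n^* + ∂_n + I) / 2`. -/
def opR (n : ℕ) : BernoulliL2 p →L[ℂ] BernoulliL2 p :=
  (1 / 2 : ℂ) • (ContinuousLinearMap.adjoint (annihilation p n) + annihilation p n + 1)

/-- `B_n^{(-1)} = L_n` and `B_n^{(+1)} = R_n`. (Only `e = -1` and `e = 1` are ever used.) -/
def opB (n : ℕ) (e : ℤ) : BernoulliL2 p →L[ℂ] BernoulliL2 p :=
  if e = -1 then opL p n else if e = 1 then opR p n else 0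

end Bernoulli

/-! ### The walk -/

/-- The set `{-1, 1}^d`, as a finite subset of `ℤ^d`. -/
def signVectors (d : ℕ) : Finset (Fin d → ℤ) := Fintype.piFinset fun _ => {-1, 1}

section Walk

variable {d : ℕ} {p : ℕ → Set.Ioo (0 : ℝ) 1}

/-- `C_n^{(ε)} = K (B_n^{(ε_1)} ⊗ ⋯ ⊗ B_n^{(ε_d)}) K⁻¹`. -/
def opC (K : TensorPower (BernoulliL2 p) d ≃ₗᵢ[ℂ] BernoulliL2 p) (n : ℕ) (ε : Fin d → ℤ) :
    BernoulliL2 p →L[ℂ] BernoulliL2 p :=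
  (K : TensorPower (BernoulliL2 p) d →L[ℂ] BernoulliL2 p) ∘L
    tensorPowerOp d (fun j => opB p n (ε j)) ∘L
      (K.symm : BernoulliL2 p →L[ℂ] TensorPower (BernoulliL2 p) d)

/-- A `d`-dimensional nucleus: a map from `ℤ^d` to the positive trace class operators on
`L²` whose traces sum to `1`. -/
def IsNucleus (ω : (Fin d → ℤ) → (BernoulliL2 p →L[ℂ] BernoulliL2 p)) : Prop :=
  (∀ x, (ω x).IsPositive ∧ IsTraceClass (ω x)) ∧ HasSum (fun x => trace (ω x)) 1

/-- The map `𝔍_n` on nuclei: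
`(𝔍_n ω)(x) = ∑_{ε ∈ {-1, 1}^d} C_n^{(ε)} ω(x - ε) C_n^{(ε)}`. -/
def nucleusStep (K : TensorPower (BernoulliL2 p) d ≃ₗᵢ[ℂ] BernoulliL2 p) (n : ℕ)
    (ω : (Fin d → ℤ) → (BernoulliL2 p →L[ℂ] BernoulliL2 p)) :
    (Fin d → ℤ) → (BernoulliL2 p →L[ℂ] BernoulliL2 p) :=
  fun x => ∑ ε ∈ signVectors d, opC K n ε ∘L ω (x - ε) ∘L opC K n ε

/-- The position space `ℓ²(ℤ^d)`. -/
abbrev PosSpace (d : ℕ) : Type := lp (fun _ : Fin d → ℤ => ℂ) 2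

/-- The basis vector `δ_x` of `ℓ²(ℤ^d)`. -/
def delta (x : Fin d → ℤ) : PosSpace d := lp.single 2 x 1

/-- The operator `|δ_x⟩⟨δ_y|` on `ℓ²(ℤ^d)`. -/
def ketBra (x y : Fin d → ℤ) : PosSpace d →L[ℂ] PosSpace d :=
  InnerProductSpace.rankOne ℂ (delta x) (delta y)

variable (d p) in
/-- The state space `ℓ²(ℤ^d) ⊗ L²` of the walk. -/
abbrev WalkSpace : Type := HTensor (PosSpace d) (BernoulliL2 p)

/-- The summand `|δ_x⟩⟨δ_x| ⊗ ω(x)` of the state with nucleus `ω`. -/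
def stateTerm (ω : (Fin d → ℤ) → (BernoulliL2 p →L[ℂ] BernoulliL2 p)) (x : Fin d → ℤ) :
    WalkSpace d p →L[ℂ] WalkSpace d p :=
  opTensor (ketBra x x) (ω x)

/-- The state `∑_x |δ_x⟩⟨δ_x| ⊗ ω(x)` with nucleus `ω`, as a sum in the trace norm. -/
def walkState (ω : (Fin d → ℤ) → (BernoulliL2 p →L[ℂ] BernoulliL2 p)) :
    WalkSpace d p →L[ℂ] WalkSpace d p :=
  traceSum (stateTerm ω)

/-- The Kraus operator `M_{x,y}^{(n)}`, equal to `|δ_x⟩⟨δ_y| ⊗ C_n^{(x - y)}` if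
`x - y ∈ {-1, 1}^d` and to `0` otherwise. -/
def krausOp (K : TensorPower (BernoulliL2 p) d ≃ₗᵢ[ℂ] BernoulliL2 p) (n : ℕ)
    (x y : Fin d → ℤ) : WalkSpace d p →L[ℂ] WalkSpace d p :=
  if x - y ∈ signVectors d then opTensor (ketBra x y) (opC K n (x - y)) else 0

/-- The summand `M_{x,y}^{(n)} T M_{x,y}^{(n)*}` of the Kraus map. -/
def krausTerm (K : TensorPower (BernoulliL2 p) d ≃ₗᵢ[ℂ] BernoulliL2 p) (n : ℕ)
    (T : WalkSpace d p →L[ℂ] WalkSpace d p) (xy : (Fin d → ℤ) × (Fin d → ℤ)) :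
    WalkSpace d p →L[ℂ] WalkSpace d p :=
  krausOp K n xy.1 xy.2 ∘L T ∘L ContinuousLinearMap.adjoint (krausOp K n xy.1 xy.2)

/-- The map `M^{(n)}(T) = ∑_{x,y} M_{x,y}^{(n)} T M_{x,y}^{(n)*}` on trace class operators, the
sum being taken in the trace norm. -/
def krausMap (K : TensorPower (BernoulliL2 p) d ≃ₗᵢ[ℂ] BernoulliL2 p) (n : ℕ)
    (T : WalkSpace d p →L[ℂ] WalkSpace d p) : WalkSpace d p →L[ℂ] WalkSpace d p :=
  traceSum (krausTerm K n T)

end Walk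

end OpenQBN

end

open OpenQBN

/-! Two facts carry the theorem. First, one step of the walk preserves total trace. Put `F = ∂_n^* +
∂_n`. Every `ξ` in a dense set is `a + Z_n b` with `a`, `b` independent of coordinate `n`, and `F`
exchanges `a` and `b`, because `Z_n` has mean zero and variance one. So `F² = 1`
(`fieldOp_mul_self`), hence `L_n² + R_n² = 1`. Expanding a tensor power of this identity and
conjugating by `K` gives `∑_ε C_ε² = 1` (`sum_opC_comp_self`), where the `C_ε` are self-adjoint.

Second, the embeddings `J_x v = δ_x ⊗ v` (`site`) are isometries with mutually orthogonal ranges.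
The state is `∑_x J_x ω(x) J_x^*`, and `M_{x,y} = J_x C_{x-y} J_y^*` sees only its diagonal block
`ω(y)`. Summing the Kraus terms over `y` therefore gives the block at `x` of the next state
(`hasSum_krausTerm_walkState_right`).

Trace-norm convergence comes from positivity: for positive operators the trace norm is a sum of
nonnegative diagonal entries, so it is countably additive (`traceNorm_of_hasSum`). A positive series
with finite total trace norm then converges in trace norm to its operator-norm sum
(`hasTraceSum_of_isPositive`). -/

noncomputable section

namespace OpenQBN

/-! ### Trace norms of positive operators and of positive series -/

section TraceClass

open scoped ComplexOrder

/-- Parseval's identity in `ℝ≥0∞`. -/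
theorem tsum_enorm_inner_sq {E : Type*} [NormedAddCommGroup E] [InnerProductSpace ℂ E] {ι : Type*}
    (b : HilbertBasis ι ℂ E) (x : E) :
    ∑' i, ‖⟪b i, x⟫_ℂ‖ₑ ^ 2 = ‖x‖ₑ ^ 2 := by
  have h := (b.hasSum_inner_mul_inner x x).mapL Complex.reCLM
  have h' : HasSum (fun i => ‖⟪b i, x⟫_ℂ‖ ^ 2) (‖x‖ ^ 2) := by
    convert h using 1
    · ext i
      rw [Complex.reCLM_apply, ← inner_conj_symm x (b i), ← Complex.normSq_eq_conj_mul_self,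
        Complex.ofReal_re, Complex.normSq_eq_norm_sq]
    · rw [Complex.reCLM_apply, inner_self_eq_norm_sq_to_K]
      norm_cast
  have h2 := ENNReal.ofReal_tsum_of_nonneg (fun i => sq_nonneg ‖⟪b i, x⟫_ℂ‖) h'.summable
  rw [h'.tsum_eq] at h2
  simpa [ENNReal.ofReal_pow, ofReal_norm] using h2.symm

variable {E F : Type*} [NormedAddCommGroup E] [InnerProductSpace ℂ E] [CompleteSpace E]
  [NormedAddCommGroup F] [InnerProductSpace ℂ F] [CompleteSpace F]

/-- The Hilbert–Schmidt sum of an operator and of its adjoint coincide, in any two bases. -/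
theorem tsum_enorm_sq_adjoint {ι κ : Type*} (b : HilbertBasis ι ℂ E) (c : HilbertBasis κ ℂ F)
    (X : E →L[ℂ] F) :
    ∑' i, ‖X (b i)‖ₑ ^ 2 = ∑' j, ‖ContinuousLinearMap.adjoint X (c j)‖ₑ ^ 2 := by
  simp_rw [← tsum_enorm_inner_sq c (X _), ← tsum_enorm_inner_sq b (ContinuousLinearMap.adjoint X _)]
  rw [ENNReal.tsum_comm]
  refine tsum_congr fun j => tsum_congr fun i => ?_
  rw [ContinuousLinearMap.adjoint_inner_right, ← inner_conj_symm (X (b i)), RCLike.enorm_conj]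

theorem traceNorm_of_isPositive {T : E →L[ℂ] E} (hT : T.IsPositive) :
    traceNorm T = ∑' i, ‖⟪stdBasis E i, T (stdBasis E i)⟫_ℂ‖ₑ := by
  rw [traceNorm, CFC.abs_of_nonneg T ((ContinuousLinearMap.nonneg_iff_isPositive T).2 hT)]

theorem traceNorm_adjoint_comp_self (X : E →L[ℂ] F) :
    traceNorm (ContinuousLinearMap.adjoint X ∘L X) = ∑' i, ‖X (stdBasis E i)‖ₑ ^ 2 := by
  rw [traceNorm_of_isPositive (ContinuousLinearMap.isPositive_adjoint_comp_self X)]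
  refine tsum_congr fun i => ?_
  rw [ContinuousLinearMap.comp_apply, ContinuousLinearMap.adjoint_inner_right,
    inner_self_eq_norm_sq_to_K, enorm_pow]
  congr 1
  rw [← ofReal_norm]
  simp

/-- Both sides are Hilbert–Schmidt sums, of `X^*` and of `X`. This is the only form of cyclicity of
the trace that is needed. -/
theorem traceNorm_self_comp_adjoint (X : E →L[ℂ] F) :
    traceNorm (X ∘L ContinuousLinearMap.adjoint X) =
      traceNorm (ContinuousLinearMap.adjoint X ∘L X) := by
  have h := traceNorm_adjoint_comp_self (ContinuousLinearMap.adjoint X)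
  rw [ContinuousLinearMap.adjoint_adjoint] at h
  rw [h, traceNorm_adjoint_comp_self, tsum_enorm_sq_adjoint (stdBasis E) (stdBasis F)]

theorem exists_sqrt {T : E →L[ℂ] E} (hT : T.IsPositive) :
    ∃ B : E →L[ℂ] E, ContinuousLinearMap.adjoint B = B ∧ B ∘L B = T := by
  have hT' := (ContinuousLinearMap.nonneg_iff_isPositive T).2 hT
  exact ⟨CFC.sqrt T, (CFC.sqrt_nonneg T).isSelfAdjoint.star_eq, CFC.sqrt_mul_sqrt_self T⟩

theorem enorm_le_traceNorm_of_isPositive {T : E →L[ℂ] E} (hT : T.IsPositive) :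
    ‖T‖ₑ ≤ traceNorm T := by
  obtain ⟨B, hB, rfl⟩ := exists_sqrt hT
  have h : traceNorm (B ∘L B) = ∑' i, ‖B (stdBasis E i)‖ₑ ^ 2 := by
    rw [← traceNorm_adjoint_comp_self, hB]
  rw [h]
  by_cases htop : ∑' i, ‖B (stdBasis E i)‖ₑ ^ 2 = ∞
  · rw [htop]; exact le_top
  -- Parseval for `B x`, then Cauchy–Schwarz on each coefficient `⟪e_i, B x⟫ = ⟪B e_i, x⟫`.
  have key : ∀ x : E, ‖B x‖ₑ ^ 2 ≤ (∑' i, ‖B (stdBasis E i)‖ₑ ^ 2) * ‖x‖ₑ ^ 2 := by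
    intro x
    rw [← tsum_enorm_inner_sq (stdBasis E) (B x), ← ENNReal.tsum_mul_right]
    refine ENNReal.tsum_le_tsum fun i => ?_
    rw [← mul_pow, ← ContinuousLinearMap.adjoint_inner_left, hB]
    gcongr
    rw [← ofReal_norm, ← ofReal_norm, ← ofReal_norm, ← ENNReal.ofReal_mul (norm_nonneg _)]
    exact ENNReal.ofReal_le_ofReal (norm_inner_le_norm _ _)
  set s := ∑' i, ‖B (stdBasis E i)‖ₑ ^ 2 with hs
  have hBn : ‖B‖ ≤ √s.toReal := by
    refine B.opNorm_le_bound (Real.sqrt_nonneg _) fun x => ?_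
    refine abs_le_of_sq_le_sq' ?_ (by positivity) |>.2
    rw [mul_pow, Real.sq_sqrt ENNReal.toReal_nonneg]
    have := ENNReal.toReal_mono (ENNReal.mul_ne_top htop (by simp)) (key x)
    simpa using this
  have h2 : ‖B ∘L B‖ ≤ s.toReal := by
    calc ‖B ∘L B‖ ≤ ‖B‖ * ‖B‖ := B.opNorm_comp_le B
      _ ≤ √s.toReal * √s.toReal := by gcongr
      _ = s.toReal := Real.mul_self_sqrt ENNReal.toReal_nonneg
  rw [← ofReal_norm, ← ENNReal.ofReal_toReal htop]
  exact ENNReal.ofReal_le_ofReal h2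

/-- Replacing `T` by `|T|` changes neither norm, which reduces to the positive case. The bound turns
trace-norm limits into operator-norm limits, where uniqueness and completeness are available. -/
theorem enorm_le_traceNorm (T : E →L[ℂ] E) : ‖T‖ₑ ≤ traceNorm T := by
  have hpos : (CFC.abs T).IsPositive :=
    (ContinuousLinearMap.nonneg_iff_isPositive _).1 (CFC.abs_nonneg T)
  have h : traceNorm (CFC.abs T) = traceNorm T := traceNorm_of_isPositive hpos
  rw [← h, ← ofReal_norm, ← CFC.norm_abs (a := T), ofReal_norm]
  exact enorm_le_traceNorm_of_isPositive hpos

theorem HasTraceSum.hasSum {ι : Type*} {f : ι → E →L[ℂ] E} {S : E →L[ℂ] E}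
    (h : HasTraceSum f S) : HasSum f S := by
  rw [HasSum, SummationFilter.unconditional_filter, tendsto_iff_edist_tendsto_0]
  refine tendsto_of_tendsto_of_tendsto_of_le_of_le tendsto_const_nhds h.2.2
    (fun _ => zero_le) fun F => ?_
  change edist _ _ ≤ _
  rw [edist_comm, edist_eq_enorm_sub]
  exact enorm_le_traceNorm _

/-- `traceSum` chooses some limit; uniqueness of operator-norm sums makes the choice immaterial. -/
theorem HasTraceSum.traceSum_eq {ι : Type*} {f : ι → E →L[ℂ] E} {S : E →L[ℂ] E}
    (h : HasTraceSum f S) : traceSum f = S := by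
  have hex : ∃ S, HasTraceSum f S := ⟨S, h⟩
  rw [traceSum, dif_pos hex]
  exact hex.choose_spec.hasSum.unique h.hasSum

theorem isPositive_of_hasSum {E : Type*} [NormedAddCommGroup E] [InnerProductSpace ℂ E]
    {ι : Type*} {f : ι → E →L[ℂ] E} {S : E →L[ℂ] E}
    (hf : ∀ i, (f i).IsPositive) (h : HasSum f S) : S.IsPositive := by
  rw [ContinuousLinearMap.isPositive_iff_complex]
  intro x
  have hx : HasSum (fun i => ⟪f i x, x⟫_ℂ) ⟪S x, x⟫_ℂ := by
    have h1 : HasSum (fun i => f i x) (S x) := h.mapL (ContinuousLinearMap.apply ℂ E x)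
    have h2 := h1.map (innerSL ℂ x : E →L[ℂ] ℂ).toLinearMap.toAddMonoidHom
      (innerSL ℂ x : E →L[ℂ] ℂ).continuous
    -- The inner product is linear in its second slot only, so the sum passes through `⟪x, f i x⟫`
    -- and is then conjugated.
    have h3 := h2.map (starRingEnd ℂ : ℂ →+* ℂ).toAddMonoidHom Complex.continuous_conj
    convert h3 using 1
    · ext i; exact (inner_conj_symm _ _).symm
    · exact (inner_conj_symm _ _).symm
  have hnn : 0 ≤ ⟪S x, x⟫_ℂ := hx.nonneg fun i => (hf i).inner_nonneg_left x
  exact ⟨Complex.conj_eq_iff_re.1 (Complex.conj_eq_iff_im.2 (Complex.nonneg_iff.1 hnn).2.symm),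
    (Complex.nonneg_iff.1 hnn).1⟩

theorem enorm_eq_ofReal_re {z : ℂ} (hz : 0 ≤ z) : ‖z‖ₑ = ENNReal.ofReal z.re := by
  rw [← ofReal_norm, ← Complex.re_eq_norm.2 hz]

/-- Tonelli: the matrix entries `⟪e_j, f i e_j⟫` are nonnegative, so the sums over `i` and `j`
commute in `ℝ≥0∞`, with no finiteness assumption. -/
theorem traceNorm_of_hasSum {ι : Type*} {f : ι → E →L[ℂ] E} {S : E →L[ℂ] E}
    (hf : ∀ i, (f i).IsPositive) (h : HasSum f S) : traceNorm S = ∑' i, traceNorm (f i) := by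
  rw [traceNorm_of_isPositive (isPositive_of_hasSum hf h)]
  simp_rw [fun i => traceNorm_of_isPositive (hf i)]
  rw [ENNReal.tsum_comm]
  refine tsum_congr fun j => ?_
  set x := stdBasis E j
  have h1 : HasSum (fun i => ⟪x, f i x⟫_ℂ) ⟪x, S x⟫_ℂ :=
    (h.mapL (ContinuousLinearMap.apply ℂ E x)).mapL (innerSL ℂ x)
  have h2 : HasSum (fun i => (⟪x, f i x⟫_ℂ).re) (⟪x, S x⟫_ℂ).re := h1.mapL Complex.reCLM
  rw [enorm_eq_ofReal_re ((isPositive_of_hasSum hf h).inner_nonneg_right x), ← h2.tsum_eq,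
    ENNReal.ofReal_tsum_of_nonneg _ h2.summable]
  · exact tsum_congr fun i => (enorm_eq_ofReal_re ((hf i).inner_nonneg_right x)).symm
  · exact fun i => (Complex.nonneg_iff.1 ((hf i).inner_nonneg_right x)).1

theorem traceNorm_finset_sum {ι : Type*} (s : Finset ι) {f : ι → E →L[ℂ] E}
    (hf : ∀ i, (f i).IsPositive) : traceNorm (∑ i ∈ s, f i) = ∑ i ∈ s, traceNorm (f i) := by
  have h : HasSum (fun i : s => f i) (∑ i ∈ s, f i) := by
    rw [← Finset.sum_coe_sort]; exact hasSum_fintype _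
  rw [traceNorm_of_hasSum (f := fun i : s => f i) (fun i => hf i) h, tsum_fintype,
    Finset.sum_coe_sort s fun i => traceNorm (f i)]

theorem summable_of_tsum_traceNorm_ne_top {ι : Type*} {f : ι → E →L[ℂ] E}
    (hf : ∑' i, traceNorm (f i) ≠ ∞) : Summable f := by
  refine Summable.of_norm_bounded (ENNReal.summable_toReal hf) fun i => ?_
  have := ENNReal.toReal_mono (ENNReal.ne_top_of_tsum_ne_top hf i) (enorm_le_traceNorm (f i))
  simpa using this

theorem hasTraceSum_of_isPositive {ι : Type*} {f : ι → E →L[ℂ] E} {S : E →L[ℂ] E}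
    (hf : ∀ i, (f i).IsPositive) (hsum : ∑' i, traceNorm (f i) ≠ ∞) (h : HasSum f S) :
    HasTraceSum f S := by
  refine ⟨fun i => (ENNReal.ne_top_of_tsum_ne_top hsum i).lt_top, ?_, ?_⟩
  · rw [IsTraceClass, traceNorm_of_hasSum hf h]; exact hsum.lt_top
  -- The remainder `S - ∑_{i ∈ s} f i` is itself a positive series over the complement of `s`, so
  -- its trace norm is exactly the tail of a convergent series.
  · refine (ENNReal.tendsto_tsum_compl_atTop_zero hsum).congr fun s => ?_
    refine (traceNorm_of_hasSum (f := fun i : {i // i ∉ s} => f i) (fun i => hf i) ?_).symm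
    have := (s.hasSum_compl_iff (f := f) (a := S - ∑ i ∈ s, f i)).2 (by simpa using h)
    exact this

theorem trace_of_isPositive {T : E →L[ℂ] E} (hT : T.IsPositive) (h : IsTraceClass T) :
    trace T = (traceNorm T).toReal := by
  rw [IsTraceClass, traceNorm_of_isPositive hT] at h
  rw [traceNorm_of_isPositive hT, ENNReal.tsum_toReal_eq (ENNReal.ne_top_of_tsum_ne_top h.ne),
    Complex.ofReal_tsum, trace]
  refine tsum_congr fun i => ?_
  rw [toReal_enorm]
  exact (Complex.eq_coe_norm_of_nonneg (hT.inner_nonneg_right _))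

/-- Conjugating by an isometry does not change the trace norm of a positive operator. -/
theorem traceNorm_conj_isometry {T : E →L[ℂ] E} (hT : T.IsPositive) (V : E →L[ℂ] F)
    (hV : ContinuousLinearMap.adjoint V ∘L V = ContinuousLinearMap.id ℂ E) :
    traceNorm (V ∘L T ∘L ContinuousLinearMap.adjoint V) = traceNorm T := by
  obtain ⟨B, hB, rfl⟩ := exists_sqrt hT
  -- With `T = B²`, the conjugate is `(VB)(VB)^*`, while `(VB)^*(VB) = B V^*V B = T`.
  have h := traceNorm_self_comp_adjoint (V ∘L B)
  rw [ContinuousLinearMap.adjoint_comp, hB] at h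
  have h1 : (B ∘L ContinuousLinearMap.adjoint V) ∘L V ∘L B =
      B ∘L (ContinuousLinearMap.adjoint V ∘L V) ∘L B := rfl
  rw [h1, hV, ContinuousLinearMap.id_comp] at h
  exact h

/-- A trace preserving completely positive map with self-adjoint Kraus operators. -/
theorem sum_traceNorm_conj {ι : Type*} (s : Finset ι) {T : E →L[ℂ] E} (hT : T.IsPositive)
    (C : ι → E →L[ℂ] E) (hC : ∀ i, ContinuousLinearMap.adjoint (C i) = C i)
    (hsum : ∑ i ∈ s, C i ∘L C i = 1) :
    ∑ i ∈ s, traceNorm (C i ∘L T ∘L C i) = traceNorm T := by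
  obtain ⟨B, hB, rfl⟩ := exists_sqrt hT
  -- Each term `(C_i B)(C_i B)^*` is flipped to `B C_i² B`, so that the `C_i²` can be summed to the
  -- identity between the two factors `B`.
  have h : ∀ i, traceNorm (C i ∘L (B ∘L B) ∘L C i) =
      traceNorm (ContinuousLinearMap.adjoint (C i ∘L B) ∘L (C i ∘L B)) := by
    intro i
    rw [← traceNorm_self_comp_adjoint, ContinuousLinearMap.adjoint_comp, hC, hB]
    rfl
  simp_rw [h]
  rw [← traceNorm_finset_sum s fun i => ContinuousLinearMap.isPositive_adjoint_comp_self _]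
  congr 1
  have h1 : ∀ i, ContinuousLinearMap.adjoint (C i ∘L B) ∘L (C i ∘L B) = B * (C i * C i) * B := by
    intro i
    rw [ContinuousLinearMap.adjoint_comp, hC, hB]
    rfl
  simp_rw [h1]
  have h2 : ∑ i ∈ s, C i * C i = 1 := hsum
  rw [← Finset.sum_mul, ← Finset.mul_sum, h2, mul_one]
  rfl

end TraceClass

/-! ### Operators on Hilbert tensor products and tensor powers -/

section Tensor

section
variable {E F G : Type*} [NormedAddCommGroup E] [InnerProductSpace ℂ E]
  [NormedAddCommGroup F] [InnerProductSpace ℂ F] [NormedAddCommGroup G] [NormedSpace ℂ G]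

/-- Bounded operators on a Hilbert tensor product are determined by elementary tensors. -/
theorem htensor_ext {S T : HTensor E F →L[ℂ] G}
    (h : ∀ a b, S ((a ⊗ₜ[ℂ] b : E ⊗[ℂ] F) : HTensor E F) =
      T ((a ⊗ₜ[ℂ] b : E ⊗[ℂ] F) : HTensor E F)) : S = T := by
  ext x
  induction x using UniformSpace.Completion.induction_on with
  | hp => exact isClosed_eq S.continuous T.continuous
  | ih x =>
    induction x using TensorProduct.induction_on with
    | zero => exact (map_zero S).trans (map_zero T).symm
    | tmul a b => exact h a b
    | add x y hx hy => rw [UniformSpace.Completion.coe_add, map_add, map_add, hx, hy]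

theorem htensor_ext_inner {x y : HTensor E F}
    (h : ∀ a b, ⟪x, ((a ⊗ₜ[ℂ] b : E ⊗[ℂ] F) : HTensor E F)⟫_ℂ =
      ⟪y, ((a ⊗ₜ[ℂ] b : E ⊗[ℂ] F) : HTensor E F)⟫_ℂ) : x = y := by
  have : innerSL ℂ x = innerSL ℂ y := htensor_ext h
  exact ext_inner_right ℂ fun v => DFunLike.congr_fun this v

theorem inner_htensor (a a' : E) (b b' : F) :
    ⟪((a ⊗ₜ[ℂ] b : E ⊗[ℂ] F) : HTensor E F), ((a' ⊗ₜ[ℂ] b' : E ⊗[ℂ] F) : HTensor E F)⟫_ℂ =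
      ⟪a, a'⟫_ℂ * ⟪b, b'⟫_ℂ := by
  rw [UniformSpace.Completion.inner_coe, TensorProduct.inner_tmul]

theorem opTensor_tmul (S : E →L[ℂ] E) (T : F →L[ℂ] F) (a : E) (b : F) :
    opTensor S T ((a ⊗ₜ[ℂ] b : E ⊗[ℂ] F) : HTensor E F) =
      ((S a ⊗ₜ[ℂ] T b : E ⊗[ℂ] F) : HTensor E F) := by
  rw [opTensor, ContinuousLinearMap.completion_apply_coe, TensorProduct.mapL_tmul]

theorem opTensor_comp (S S' : E →L[ℂ] E) (T T' : F →L[ℂ] F) :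
    opTensor S T ∘L opTensor S' T' = opTensor (S ∘L S') (T ∘L T') :=
  htensor_ext fun a b => by simp [opTensor_tmul]

theorem opTensor_one : opTensor (1 : E →L[ℂ] E) (1 : F →L[ℂ] F) = 1 :=
  htensor_ext fun a b => by simp [opTensor_tmul]

theorem opTensor_sum_left {ι : Type*} (s : Finset ι) (S : ι → E →L[ℂ] E) (T : F →L[ℂ] F) :
    opTensor (∑ i ∈ s, S i) T = ∑ i ∈ s, opTensor (S i) T :=
  htensor_ext fun a b => by
    simp only [opTensor_tmul, _root_.sum_apply, TensorProduct.sum_tmul]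
    exact map_sum UniformSpace.Completion.toCompl _ _

theorem opTensor_sum_right {ι : Type*} (s : Finset ι) (S : E →L[ℂ] E) (T : ι → F →L[ℂ] F) :
    opTensor S (∑ i ∈ s, T i) = ∑ i ∈ s, opTensor S (T i) :=
  htensor_ext fun a b => by
    simp only [opTensor_tmul, _root_.sum_apply, TensorProduct.tmul_sum]
    exact map_sum UniformSpace.Completion.toCompl _ _

theorem adjoint_opTensor [CompleteSpace E] [CompleteSpace F] (S : E →L[ℂ] E) (T : F →L[ℂ] F) :
    ContinuousLinearMap.adjoint (opTensor S T) =
      opTensor (ContinuousLinearMap.adjoint S) (ContinuousLinearMap.adjoint T) :=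
  htensor_ext fun a b => htensor_ext_inner fun a' b' => by
    rw [ContinuousLinearMap.adjoint_inner_left, opTensor_tmul, opTensor_tmul, inner_htensor,
      inner_htensor, ContinuousLinearMap.adjoint_inner_left, ContinuousLinearMap.adjoint_inner_left]

variable (F) in
/-- The operator `v ↦ a ⊗ v`. -/
def tmulLeft (a : E) : F →L[ℂ] HTensor E F :=
  UniformSpace.Completion.toComplL ∘L TensorProduct.mkL ℂ E F a

theorem tmulLeft_apply (a : E) (v : F) :
    tmulLeft F a v = ((a ⊗ₜ[ℂ] v : E ⊗[ℂ] F) : HTensor E F) := rfl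

variable [CompleteSpace F]

theorem adjoint_tmulLeft_tmul (a b : E) (v : F) :
    ContinuousLinearMap.adjoint (tmulLeft F a) ((b ⊗ₜ[ℂ] v : E ⊗[ℂ] F) : HTensor E F) =
      ⟪a, b⟫_ℂ • v := by
  refine ext_inner_left ℂ fun w => ?_
  rw [ContinuousLinearMap.adjoint_inner_right, tmulLeft_apply, inner_htensor, inner_smul_right]

theorem adjoint_tmulLeft_comp_tmulLeft (a b : E) :
    ContinuousLinearMap.adjoint (tmulLeft F a) ∘L tmulLeft F b =
      ⟪a, b⟫_ℂ • ContinuousLinearMap.id ℂ F := by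
  ext v
  simp [tmulLeft_apply, adjoint_tmulLeft_tmul]

/-- Factoring through `F` lets the operators on the walk space be handled by composition alone,
without further recourse to elementary tensors. -/
theorem opTensor_rankOne (a b : E) (T : F →L[ℂ] F) :
    opTensor (InnerProductSpace.rankOne ℂ a b) T =
      tmulLeft F a ∘L T ∘L ContinuousLinearMap.adjoint (tmulLeft F b) :=
  htensor_ext fun u v => by
    simp [opTensor_tmul, tmulLeft_apply, adjoint_tmulLeft_tmul, TensorProduct.smul_tmul]

end

variable {E : Type} [NormedAddCommGroup E] [InnerProductSpace ℂ E]

theorem tensorPowerOp_succ (d : ℕ) (B : Fin (d + 1) → E →L[ℂ] E) :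
    tensorPowerOp (d + 1) B = opTensor (B 0) (tensorPowerOp d fun j => B j.succ) := rfl

theorem tensorPowerOp_comp (d : ℕ) (B B' : Fin d → E →L[ℂ] E) :
    tensorPowerOp d B ∘L tensorPowerOp d B' = tensorPowerOp d fun j => B j ∘L B' j := by
  induction d with
  | zero => rfl
  | succ d ih =>
    rw [tensorPowerOp_succ, tensorPowerOp_succ, tensorPowerOp_succ, ← ih]
    exact opTensor_comp _ _ _ _

theorem tensorPowerOp_one (d : ℕ) : tensorPowerOp d (fun _ => (1 : E →L[ℂ] E)) = 1 := by
  induction d with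
  | zero => rfl
  | succ d ih =>
    rw [tensorPowerOp_succ, ih]
    exact opTensor_one

theorem adjoint_tensorPowerOp [CompleteSpace E] (d : ℕ) (B : Fin d → E →L[ℂ] E) :
    ContinuousLinearMap.adjoint (tensorPowerOp d B) =
      tensorPowerOp d fun j => ContinuousLinearMap.adjoint (B j) := by
  induction d with
  | zero => exact ContinuousLinearMap.adjoint_id
  | succ d ih =>
    rw [tensorPowerOp_succ, tensorPowerOp_succ, ← ih]
    exact adjoint_opTensor _ _

/-- Multilinear expansion of `(∑ D e)^{⊗ d}`, by induction on `d`: a choice of indices splits into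
its head and its tail. -/
theorem sum_tensorPowerOp {α : Type*} [DecidableEq α] (d : ℕ) (s : Finset α) (D : α → E →L[ℂ] E) :
    ∑ ε ∈ Fintype.piFinset (fun _ : Fin d => s), tensorPowerOp d (fun j => D (ε j)) =
      tensorPowerOp d fun _ => ∑ e ∈ s, D e := by
  induction d with
  | zero => simp; rfl
  | succ d ih =>
    rw [tensorPowerOp_succ, ← ih]
    refine Eq.trans ?_ (opTensor_sum_left _ _ _).symm
    simp_rw [opTensor_sum_right]
    rw [← Finset.sum_product']
    refine Finset.sum_bij' (fun ε _ => (ε 0, fun j => ε j.succ)) (fun x _ => Fin.cons x.1 x.2)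
      ?_ ?_ ?_ ?_ ?_
    · intro ε hε
      simp only [Fintype.mem_piFinset] at hε
      simp [hε]
    · rintro ⟨a, ε⟩ hε
      simp only [Finset.mem_product, Fintype.mem_piFinset] at hε
      simpa [Fin.forall_fin_succ] using hε
    · intro ε _
      exact Fin.cons_self_tail ε
    · rintro ⟨a, ε⟩ _
      simp
    · intro ε _
      rfl

end Tensor

/-! ### The involution `∂_k^* + ∂_k` and the operators `L_n`, `R_n` -/

section Bernoulli

variable (p : ℕ → Set.Ioo (0 : ℝ) 1)

/-- The factor `F` comes out of the conditional expectation, and `g` of the independent coordinate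
`k` is replaced by its mean. Compared with `condExcept_mul`, `F` need not be a product of `Z_j`, so
no completeness of the family `Z_σ` is required below. -/
theorem condExcept_mul_coord (k : ℕ) {F : Omega → ℂ} (hF : StronglyMeasurable[sigmaExcept k] F)
    (hF2 : MemLp F 2 (bernoulli p)) (g : ℤˣ → ℂ) (ξ : BernoulliL2 p)
    (hξ : ξ =ᵐ[bernoulli p] fun ω => F ω * g (ω k)) :
    condExcept p k ξ = (∫ ω, g (ω k) ∂(bernoulli p)) • hF2.toLp F := by
  have hle := sigmaExcept_le k
  have hg : MemLp (fun ω : Omega => g (ω k)) 2 (bernoulli p) := by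
    refine MemLp.of_bound ((measurable_of_finite g).comp
      (measurable_pi_apply k)).aestronglyMeasurable (‖g 1‖ + ‖g (-1)‖)
      (Eventually.of_forall fun ω => ?_)
    rcases Int.units_eq_one_or (ω k) with h | h <;> rw [h] <;>
      linarith [norm_nonneg (g 1), norm_nonneg (g (-1))]
  have hprod : Integrable (F * fun ω : Omega => g (ω k)) (bernoulli p) :=
    ((Lp.memLp ξ).integrable one_le_two).congr hξ
  have h1 : condExcept p k ξ =ᵐ[bernoulli p] (bernoulli p)[ξ | sigmaExcept k] := by
    have := MemLp.condExpL2_ae_eq_condExp (𝕜 := ℂ) hle (Lp.memLp ξ)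
    rw [Lp.toLp_coeFn] at this
    exact this
  have h2 : (bernoulli p)[ξ | sigmaExcept k] =ᵐ[bernoulli p]
      (bernoulli p)[F * fun ω => g (ω k) | sigmaExcept k] := condExp_congr_ae hξ
  have h3 := condExp_bilin_of_stronglyMeasurable_left (ContinuousLinearMap.mul ℝ ℂ)
    (μ := bernoulli p) hF hprod (hg.integrable one_le_two)
  have h4 : (bernoulli p)[fun ω => g (ω k) | sigmaExcept k] =ᵐ[bernoulli p]
      fun _ => ∫ ω, g (ω k) ∂(bernoulli p) := by
    refine condExp_indep_eq (measurable_pi_apply k).comap_le hle ?_ (indep_coord p k)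
    exact ((measurable_of_finite g).comp (comap_measurable _)).stronglyMeasurable
  refine Lp.ext ?_
  filter_upwards [h1, h2, h3, h4, Lp.coeFn_smul (∫ ω, g (ω k) ∂(bernoulli p)) (hF2.toLp F),
    hF2.coeFn_toLp] with ω h1 h2 h3 h4 h5 h6
  rw [h1, h2]
  refine h3.trans ?_
  rw [h4, h5, Pi.smul_apply, h6, smul_eq_mul, mul_comm]
  rfl

/-- The self-adjoint operator `∂_k^* + ∂_k`. -/
def fieldOp (k : ℕ) : BernoulliL2 p →L[ℂ] BernoulliL2 p :=
  ContinuousLinearMap.adjoint (annihilation p k) + annihilation p k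

theorem fieldOp_apply (k : ℕ) (ξ : BernoulliL2 p) :
    fieldOp p k ξ = mulZ p k (condExcept p k ξ) + condExcept p k (mulZ p k ξ) := by
  rw [fieldOp, annihilation, ContinuousLinearMap.adjoint_comp, adjoint_condExcept, adjoint_mulZ]
  rfl

/-- Write `P` for `condExcept` and `Z` for `mulZ`, so that the operator is `ZP + PZ`. Here `P` fixes
`a` and `b`, `P Z` kills them (mean zero), and `P Z²` fixes them (variance one). -/
theorem fieldOp_toLp_add_mulZ (k : ℕ) {a b : Omega → ℂ} (ha : StronglyMeasurable[sigmaExcept k] a)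
    (ha2 : MemLp a 2 (bernoulli p)) (hb : StronglyMeasurable[sigmaExcept k] b)
    (hb2 : MemLp b 2 (bernoulli p)) :
    fieldOp p k (ha2.toLp a + mulZ p k (hb2.toLp b)) = hb2.toLp b + mulZ p k (ha2.toLp a) := by
  have h0 : ∀ {c : Omega → ℂ} (_ : StronglyMeasurable[sigmaExcept k] c)
      (hc2 : MemLp c 2 (bernoulli p)), condExcept p k (hc2.toLp c) = hc2.toLp c := by
    intro c hc hc2
    rw [condExcept_mul_coord p k hc hc2 (fun _ => 1)]
    · simp
    · filter_upwards [hc2.coeFn_toLp] with ω h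
      rw [h, mul_one]
  have h1 : ∀ {c : Omega → ℂ} (_ : StronglyMeasurable[sigmaExcept k] c)
      (hc2 : MemLp c 2 (bernoulli p)), condExcept p k (mulZ p k (hc2.toLp c)) = 0 := by
    intro c hc hc2
    rw [condExcept_mul_coord p k hc hc2 (fun e => (zVal (p k) e : ℂ)), integral_zVal, zero_smul]
    filter_upwards [mulZ_ae p k (hc2.toLp c), hc2.coeFn_toLp] with ω h h'
    rw [h, h', mul_comm]
  have h2 : ∀ {c : Omega → ℂ} (_ : StronglyMeasurable[sigmaExcept k] c)
      (hc2 : MemLp c 2 (bernoulli p)),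
      condExcept p k (mulZ p k (mulZ p k (hc2.toLp c))) = hc2.toLp c := by
    intro c hc hc2
    rw [condExcept_mul_coord p k hc hc2 (fun e => (zVal (p k) e : ℂ) ^ 2), integral_zVal_sq,
      one_smul]
    filter_upwards [mulZ_ae p k (mulZ p k (hc2.toLp c)), mulZ_ae p k (hc2.toLp c),
      hc2.coeFn_toLp] with ω h h' h''
    rw [h, h', h'']
    ring
  rw [fieldOp_apply, map_add, map_add, map_add, map_add, h0 ha ha2, h1 hb hb2, h1 ha ha2, h2 hb hb2,
    map_zero]
  abel

theorem zVal_one_sub_zVal_neg_one (p : Set.Ioo (0 : ℝ) 1) : zVal p 1 - zVal p (-1) ≠ 0 := by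
  have h : 0 < √((p : ℝ) * (1 - p)) := Real.sqrt_pos.2 (mul_pos p.2.1 (sub_pos.2 p.2.2))
  have h2 : zVal p 1 - zVal p (-1) = 1 / √((p : ℝ) * (1 - p)) := by
    simp only [zVal]
    push_cast
    field_simp
    ring
  rw [h2]
  positivity

theorem measurable_update_sigmaExcept (k : ℕ) (e : ℤˣ) :
    Measurable[sigmaExcept k] fun ω : Omega => Function.update ω k e := by
  refine @measurable_pi_lambda _ _ _ (sigmaExcept k) _ _ fun j => ?_
  rcases eq_or_ne j k with rfl | hj
  · simp
  · simp only [Function.update_of_ne hj]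
    rw [measurable_iff_comap_le]
    exact le_iSup₂_of_le j hj le_rfl

/-- A bounded function is `a + Z_k b` with `a`, `b` bounded and independent of coordinate `k`. -/
theorem exists_eq_toLp_add_mulZ (k : ℕ) (ξ : BernoulliL2 p) {f : Omega → ℂ} (hf : Measurable f)
    {C : ℝ} (hC : ∀ ω, ‖f ω‖ ≤ C) (hξ : ξ =ᵐ[bernoulli p] f) :
    ∃ (a b : Omega → ℂ) (ha : MemLp a 2 (bernoulli p)) (hb : MemLp b 2 (bernoulli p)),
      StronglyMeasurable[sigmaExcept k] a ∧ StronglyMeasurable[sigmaExcept k] b ∧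
        ξ = ha.toLp a + mulZ p k (hb.toLp b) := by
  set u : ℂ := (zVal (p k) 1 : ℂ) with hu
  set v : ℂ := (zVal (p k) (-1) : ℂ) with hv
  have huv : u - v ≠ 0 := by
    rw [hu, hv]
    exact_mod_cast zVal_one_sub_zVal_neg_one (p k)
  -- `F e` freezes coordinate `k` at `e`. The functions `a`, `b` below solve `a + u b = F 1` and `a
  -- + v b = F (-1)`, which is possible since `u ≠ v`.
  let F : ℤˣ → Omega → ℂ := fun e ω => f (Function.update ω k e)
  have hFm : ∀ e, StronglyMeasurable[sigmaExcept k] (F e) := fun e =>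
    (hf.comp (measurable_update_sigmaExcept k e)).stronglyMeasurable
  have hF2 : ∀ e, MemLp (F e) 2 (bernoulli p) := fun e =>
    MemLp.of_bound ((hFm e).mono (sigmaExcept_le k)).aestronglyMeasurable C
      (Eventually.of_forall fun ω => hC _)
  let b : Omega → ℂ := (u - v)⁻¹ • (F 1 - F (-1))
  let a : Omega → ℂ := F 1 - u • b
  have hbm : StronglyMeasurable[sigmaExcept k] b := ((hFm 1).sub (hFm (-1))).const_smul _
  have hb2 : MemLp b 2 (bernoulli p) := ((hF2 1).sub (hF2 (-1))).const_smul _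
  have ham : StronglyMeasurable[sigmaExcept k] a := (hFm 1).sub (hbm.const_smul _)
  have ha2 : MemLp a 2 (bernoulli p) := (hF2 1).sub (hb2.const_smul _)
  refine ⟨a, b, ha2, hb2, ham, hbm, Lp.ext ?_⟩
  filter_upwards [hξ, Lp.coeFn_add (ha2.toLp a) (mulZ p k (hb2.toLp b)), ha2.coeFn_toLp,
    hb2.coeFn_toLp, mulZ_ae p k (hb2.toLp b)] with ω h1 h2 h3 h4 h5
  rw [h1, h2, Pi.add_apply, h3, h5, h4]
  have hω : f ω = F (ω k) ω := by simp [F]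
  rw [hω]
  simp only [a, b, Pi.sub_apply, Pi.smul_apply, smul_eq_mul]
  rcases Int.units_eq_one_or (ω k) with h | h <;> rw [h]
  · rw [← hu]; ring
  · rw [← hv]; field_simp; ring

/-- Exchanging `a` and `b` twice is the identity. Indicators are bounded, hence of the form `a + Z_k
b`, and linearity with continuity extends the identity to all of `L²`. -/
theorem fieldOp_fieldOp (k : ℕ) (ξ : BernoulliL2 p) : fieldOp p k (fieldOp p k ξ) = ξ := by
  induction ξ using Lp.induction with
  | hp_ne_top => exact ENNReal.ofNat_ne_top
  | indicatorConst c hs hμs =>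
    rename_i s
    obtain ⟨a, b, ha2, hb2, ha, hb, h⟩ := exists_eq_toLp_add_mulZ p k
      (Lp.simpleFunc.indicatorConst 2 hs hμs.ne c : BernoulliL2 p)
      (f := s.indicator fun _ => c) (measurable_const.indicator hs) (C := ‖c‖)
      (fun ω => norm_indicator_le_norm_self _ _)
      (by rw [Lp.simpleFunc.coe_indicatorConst]; exact indicatorConstLp_coeFn)
    rw [h, fieldOp_toLp_add_mulZ p k ha ha2 hb hb2, fieldOp_toLp_add_mulZ p k hb hb2 ha ha2]
  | add hf hg _ h1 h2 => rw [map_add, map_add, h1, h2]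
  | isClosed =>
    exact isClosed_eq ((fieldOp p k).continuous.comp (fieldOp p k).continuous) continuous_id

theorem fieldOp_mul_self (k : ℕ) : fieldOp p k * fieldOp p k = 1 :=
  ContinuousLinearMap.ext (fieldOp_fieldOp p k)

theorem adjoint_fieldOp (k : ℕ) : ContinuousLinearMap.adjoint (fieldOp p k) = fieldOp p k := by
  rw [fieldOp, map_add, ContinuousLinearMap.adjoint_adjoint, add_comm]

theorem opB_neg_one (n : ℕ) : opB p n (-1) = (1 / 2 : ℂ) • (fieldOp p n - 1) := rfl

theorem opB_one (n : ℕ) : opB p n 1 = (1 / 2 : ℂ) • (fieldOp p n + 1) := rfl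

/-- The default value `0` for `e ≠ ±1` is self-adjoint too, so `adjoint_opC` holds for every `ε` in
`ℤ^d`. -/
theorem adjoint_opB (n : ℕ) (e : ℤ) : ContinuousLinearMap.adjoint (opB p n e) = opB p n e := by
  have h1 : ContinuousLinearMap.adjoint (1 : BernoulliL2 p →L[ℂ] BernoulliL2 p) = 1 :=
    ContinuousLinearMap.adjoint_id
  have hc : (starRingEnd ℂ) (1 / 2 : ℂ) = 1 / 2 := Complex.ext (by simp) (by simp)
  by_cases he : e = -1
  · rw [he, opB_neg_one, map_smulₛₗ, map_sub, adjoint_fieldOp, h1, hc]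
  by_cases he' : e = 1
  · rw [he', opB_one, map_smulₛₗ, map_add, adjoint_fieldOp, h1, hc]
  · rw [opB, if_neg he, if_neg he', map_zero]

/-- With `F² = 1`, `((F - 1)² + (F + 1)²) / 4 = (F² + 1) / 2 = 1`. -/
theorem sum_opB_comp_self (n : ℕ) : ∑ e ∈ ({-1, 1} : Finset ℤ), opB p n e ∘L opB p n e = 1 := by
  rw [Finset.sum_pair (by norm_num), opB_neg_one, opB_one]
  change ((1 / 2 : ℂ) • (fieldOp p n - 1)) * ((1 / 2 : ℂ) • (fieldOp p n - 1)) +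
    ((1 / 2 : ℂ) • (fieldOp p n + 1)) * ((1 / 2 : ℂ) • (fieldOp p n + 1)) = 1
  simp only [smul_mul_smul_comm, sub_mul, mul_sub, add_mul, mul_add, fieldOp_mul_self, mul_one,
    one_mul]
  module

end Bernoulli

/-! ### The Kraus identity for the operators `C_n^{(ε)}` -/

section OpC

variable {d : ℕ} {p : ℕ → Set.Ioo (0 : ℝ) 1}
  (K : TensorPower (BernoulliL2 p) d ≃ₗᵢ[ℂ] BernoulliL2 p)

theorem adjoint_opC (n : ℕ) (ε : Fin d → ℤ) :
    ContinuousLinearMap.adjoint (opC K n ε) = opC K n ε := by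
  refine ((ContinuousLinearMap.eq_adjoint_iff _ _).2 fun x y => ?_).symm
  have h : ContinuousLinearMap.adjoint (tensorPowerOp d fun j => opB p n (ε j)) =
      tensorPowerOp d fun j => opB p n (ε j) := by
    rw [adjoint_tensorPowerOp]
    simp_rw [adjoint_opB]
  change ⟪K (tensorPowerOp d (fun j => opB p n (ε j)) (K.symm x)), y⟫_ℂ =
    ⟪x, K (tensorPowerOp d (fun j => opB p n (ε j)) (K.symm y))⟫_ℂ
  rw [← K.symm.inner_map_map, K.symm_apply_apply, ← K.symm.inner_map_map x, K.symm_apply_apply,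
    ← ContinuousLinearMap.adjoint_inner_right, h]

theorem sum_opC_comp_self (n : ℕ) : ∑ ε ∈ signVectors d, opC K n ε ∘L opC K n ε = 1 := by
  have h := sum_tensorPowerOp d ({-1, 1} : Finset ℤ) fun e => opB p n e ∘L opB p n e
  rw [sum_opB_comp_self, tensorPowerOp_one] at h
  ext1 x
  have hx := congrArg K (DFunLike.congr_fun h (K.symm x))
  rw [_root_.sum_apply, map_sum, one_apply_eq_self, K.apply_symm_apply] at hx
  rw [_root_.sum_apply, one_apply_eq_self]
  refine Eq.trans (Finset.sum_congr rfl fun ε _ => ?_) hx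
  rw [← tensorPowerOp_comp]
  change K (tensorPowerOp d _ (K.symm (K (tensorPowerOp d _ (K.symm x))))) = _
  rw [K.symm_apply_apply]
  rfl

end OpC

/-! ### Nuclei, states and the Kraus map -/

section Walk

variable {d : ℕ} {p : ℕ → Set.Ioo (0 : ℝ) 1}
  {ω : (Fin d → ℤ) → (BernoulliL2 p →L[ℂ] BernoulliL2 p)}

/-- For positive operators trace and trace norm agree; in `ℝ≥0∞` sums can be rearranged without
summability conditions. -/
theorem isNucleus_iff : IsNucleus ω ↔ (∀ x, (ω x).IsPositive) ∧ ∑' x, traceNorm (ω x) = 1 := by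
  constructor
  · rintro ⟨hω, hsum⟩
    refine ⟨fun x => (hω x).1, ?_⟩
    have h : HasSum (fun x => (traceNorm (ω x)).toReal) 1 := by
      rw [← Complex.hasSum_ofReal]
      simpa only [Complex.ofReal_one, trace_of_isPositive (hω _).1 (hω _).2] using hsum
    have h2 := ENNReal.ofReal_tsum_of_nonneg (fun _ => ENNReal.toReal_nonneg) h.summable
    rw [h.tsum_eq, ENNReal.ofReal_one] at h2
    rw [h2]
    exact tsum_congr fun x => (ENNReal.ofReal_toReal (hω x).2.ne).symm
  · rintro ⟨hω, hsum⟩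
    have htop : ∑' x, traceNorm (ω x) ≠ ∞ := hsum ▸ ENNReal.one_ne_top
    have htc : ∀ x, IsTraceClass (ω x) := fun x => (ENNReal.ne_top_of_tsum_ne_top htop x).lt_top
    refine ⟨fun x => ⟨hω x, htc x⟩, ?_⟩
    have h := ENNReal.hasSum_toReal htop
    rw [← ENNReal.tsum_toReal_eq (ENNReal.ne_top_of_tsum_ne_top htop), hsum, ENNReal.toReal_one,
      ← Complex.hasSum_ofReal] at h
    simpa only [Complex.ofReal_one, trace_of_isPositive (hω _) (htc _)] using h

theorem isPositive_opC_conj (K : TensorPower (BernoulliL2 p) d ≃ₗᵢ[ℂ] BernoulliL2 p) (n : ℕ)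
    (ε : Fin d → ℤ) {T : BernoulliL2 p →L[ℂ] BernoulliL2 p} (hT : T.IsPositive) :
    (opC K n ε ∘L T ∘L opC K n ε).IsPositive := by
  have h := hT.conj_adjoint (opC K n ε)
  rwa [adjoint_opC] at h

theorem IsNucleus.nucleusStep (hω : IsNucleus ω)
    (K : TensorPower (BernoulliL2 p) d ≃ₗᵢ[ℂ] BernoulliL2 p) (n : ℕ) :
    IsNucleus (nucleusStep K n ω) := by
  rw [isNucleus_iff] at hω ⊢
  obtain ⟨hpos, hsum⟩ := hω
  refine ⟨fun x => ContinuousLinearMap.isPositive_sum _ fun ε _ =>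
    isPositive_opC_conj K n ε (hpos _), ?_⟩
  have h : ∀ x, traceNorm (OpenQBN.nucleusStep K n ω x) =
      ∑ ε ∈ signVectors d, traceNorm (opC K n ε ∘L ω (x - ε) ∘L opC K n ε) := fun x =>
    traceNorm_finset_sum _ fun ε => isPositive_opC_conj K n ε (hpos _)
  simp_rw [h]
  rw [Summable.tsum_finsetSum fun _ _ => ENNReal.summable]
  -- For fixed `ε` the shift by `ε` permutes `ℤ^d`; afterwards all terms at a site `y` conjugate the
  -- same operator `ω y`, and trace preservation applies site by site.
  have h2 : ∀ ε : Fin d → ℤ, ∑' x, traceNorm (opC K n ε ∘L ω (x - ε) ∘L opC K n ε) =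
      ∑' y, traceNorm (opC K n ε ∘L ω y ∘L opC K n ε) := fun ε =>
    (Equiv.subRight ε).tsum_eq fun y => traceNorm (opC K n ε ∘L ω y ∘L opC K n ε)
  simp_rw [h2]
  rw [← Summable.tsum_finsetSum fun _ _ => ENNReal.summable, ← hsum]
  exact tsum_congr fun y => sum_traceNorm_conj _ (hpos y) _ (adjoint_opC K n) (sum_opC_comp_self K n)

theorem inner_delta (x y : Fin d → ℤ) : ⟪delta x, delta y⟫_ℂ = if x = y then 1 else 0 := by
  rw [delta, delta, lp.inner_single_left, lp.coeFn_single, Pi.single_apply]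
  split_ifs <;> simp

variable (p) in
/-- The embedding `v ↦ δ_x ⊗ v` of `L²` at the site `x`. -/
def site (x : Fin d → ℤ) : BernoulliL2 p →L[ℂ] WalkSpace d p := tmulLeft _ (delta x)

theorem adjoint_site_comp_site (x y : Fin d → ℤ) :
    ContinuousLinearMap.adjoint (site p x) ∘L site p y =
      if x = y then ContinuousLinearMap.id ℂ _ else 0 := by
  rw [site, site, adjoint_tmulLeft_comp_tmulLeft, inner_delta, ite_smul, one_smul, zero_smul]

theorem traceNorm_site_conj (x : Fin d → ℤ) {T : BernoulliL2 p →L[ℂ] BernoulliL2 p}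
    (hT : T.IsPositive) :
    traceNorm (site p x ∘L T ∘L ContinuousLinearMap.adjoint (site p x)) = traceNorm T :=
  traceNorm_conj_isometry hT _ (by rw [adjoint_site_comp_site, if_pos rfl])

theorem stateTerm_eq (x : Fin d → ℤ) :
    stateTerm ω x = site p x ∘L ω x ∘L ContinuousLinearMap.adjoint (site p x) :=
  opTensor_rankOne _ _ _

theorem isPositive_stateTerm (hω : ∀ x, (ω x).IsPositive) (x : Fin d → ℤ) :
    (stateTerm ω x).IsPositive := by
  rw [stateTerm_eq]
  exact (hω x).conj_adjoint _

theorem traceNorm_stateTerm (hω : ∀ x, (ω x).IsPositive) (x : Fin d → ℤ) :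
    traceNorm (stateTerm ω x) = traceNorm (ω x) := by
  rw [stateTerm_eq, traceNorm_site_conj x (hω x)]

theorem IsNucleus.tsum_traceNorm_stateTerm (hω : IsNucleus ω) :
    ∑' x, traceNorm (stateTerm ω x) = 1 := by
  obtain ⟨hpos, hsum⟩ := isNucleus_iff.1 hω
  simp_rw [traceNorm_stateTerm hpos]
  exact hsum

theorem IsNucleus.hasTraceSum_stateTerm (hω : IsNucleus ω) :
    HasTraceSum (stateTerm ω) (walkState ω) := by
  have htop : ∑' x, traceNorm (stateTerm ω x) ≠ ∞ :=
    hω.tsum_traceNorm_stateTerm ▸ ENNReal.one_ne_top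
  have h := hasTraceSum_of_isPositive (isPositive_stateTerm (isNucleus_iff.1 hω).1) htop
    (summable_of_tsum_traceNorm_ne_top htop).hasSum
  rw [walkState, h.traceSum_eq]
  exact h

theorem IsNucleus.isDensity_walkState (hω : IsNucleus ω) : IsDensity (walkState ω) := by
  have h := hω.hasTraceSum_stateTerm
  have hpos := isPositive_stateTerm (isNucleus_iff.1 hω).1
  have hS := isPositive_of_hasSum hpos h.hasSum
  refine ⟨hS, h.2.1, ?_⟩
  rw [trace_of_isPositive hS h.2.1, traceNorm_of_hasSum hpos h.hasSum, hω.tsum_traceNorm_stateTerm]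
  simp

/-- The diagonal blocks of the state are the values of the nucleus. -/
theorem IsNucleus.adjoint_site_walkState_site (hω : IsNucleus ω) (y : Fin d → ℤ) :
    ContinuousLinearMap.adjoint (site p y) ∘L walkState ω ∘L site p y = ω y := by
  ext1 v
  have h : HasSum (fun x => ContinuousLinearMap.adjoint (site p y) (stateTerm ω x (site p y v)))
      (ContinuousLinearMap.adjoint (site p y) (walkState ω (site p y v))) :=
    (hω.hasTraceSum_stateTerm.hasSum.mapL (ContinuousLinearMap.apply ℂ _ (site p y v))).mapL
      (ContinuousLinearMap.adjoint (site p y))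
  have hx : ∀ x, ContinuousLinearMap.adjoint (site p y) (stateTerm ω x (site p y v)) =
      if x = y then ω y v else 0 := by
    intro x
    have h1 := DFunLike.congr_fun (adjoint_site_comp_site (p := p) x y) v
    rw [ContinuousLinearMap.comp_apply] at h1
    rw [stateTerm_eq, ContinuousLinearMap.comp_apply, ContinuousLinearMap.comp_apply, h1]
    split_ifs with hxy
    · subst hxy
      exact DFunLike.congr_fun ((adjoint_site_comp_site (p := p) x x).trans (if_pos rfl)) _
    · simp
  simp_rw [hx] at h
  exact h.unique (hasSum_ite_eq y _)

/-- The factors `J_y^*` and `J_y` of `M_{x,y}` and its adjoint meet around the state and extract its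
diagonal block at `y`. -/
theorem krausTerm_walkState (hω : IsNucleus ω)
    (K : TensorPower (BernoulliL2 p) d ≃ₗᵢ[ℂ] BernoulliL2 p) (n : ℕ) (x y : Fin d → ℤ) :
    krausTerm K n (walkState ω) (x, y) =
      if x - y ∈ signVectors d then
        site p x ∘L (opC K n (x - y) ∘L ω y ∘L opC K n (x - y)) ∘L
          ContinuousLinearMap.adjoint (site p x)
      else 0 := by
  rw [krausTerm, krausOp]
  split_ifs with h
  · have hk : opTensor (ketBra x y) (opC K n (x - y)) =
        site p x ∘L opC K n (x - y) ∘L ContinuousLinearMap.adjoint (site p y) :=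
      opTensor_rankOne _ _ _
    rw [hk, ContinuousLinearMap.adjoint_comp, ContinuousLinearMap.adjoint_comp,
      ContinuousLinearMap.adjoint_adjoint, adjoint_opC, ← hω.adjoint_site_walkState_site y]
    rfl
  · exact ContinuousLinearMap.zero_comp _

theorem isPositive_krausTerm_walkState (hω : IsNucleus ω)
    (K : TensorPower (BernoulliL2 p) d ≃ₗᵢ[ℂ] BernoulliL2 p) (n : ℕ)
    (xy : (Fin d → ℤ) × (Fin d → ℤ)) : (krausTerm K n (walkState ω) xy).IsPositive :=
  hω.isDensity_walkState.1.conj_adjoint _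

theorem hasSum_krausTerm_walkState_right (hω : IsNucleus ω)
    (K : TensorPower (BernoulliL2 p) d ≃ₗᵢ[ℂ] BernoulliL2 p) (n : ℕ) (x : Fin d → ℤ) :
    HasSum (fun y => krausTerm K n (walkState ω) (x, y)) (stateTerm (nucleusStep K n ω) x) := by
  -- Substituting `y = x - ε` leaves a sum over `ε` supported on the finite set of sign vectors.
  rw [← (Equiv.subLeft x).hasSum_iff]
  have h : stateTerm (nucleusStep K n ω) x =
      ∑ ε ∈ signVectors d, krausTerm K n (walkState ω) (x, x - ε) := by
    rw [stateTerm_eq, nucleusStep, ContinuousLinearMap.finsetSum_comp,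
      ContinuousLinearMap.comp_finsetSum]
    refine Finset.sum_congr rfl fun ε hε => ?_
    rw [krausTerm_walkState hω, sub_sub_cancel, if_pos hε]
  rw [h]
  refine hasSum_sum_of_ne_finset_zero fun ε hε => ?_
  rw [Function.comp_apply, Equiv.subLeft_apply, krausTerm_walkState hω, sub_sub_cancel, if_neg hε]

theorem hasTraceSum_krausTerm_walkState (hω : IsNucleus ω)
    (K : TensorPower (BernoulliL2 p) d ≃ₗᵢ[ℂ] BernoulliL2 p) (n : ℕ) :
    HasTraceSum (krausTerm K n (walkState ω)) (walkState (nucleusStep K n ω)) := by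
  have hpos := isPositive_krausTerm_walkState hω K n
  have hstep := hω.nucleusStep K n
  have htop : ∑' xy, traceNorm (krausTerm K n (walkState ω) xy) ≠ ∞ := by
    -- Summing over `y` first turns the double series into the total trace norm of the next state,
    -- which is `1`.
    rw [ENNReal.tsum_prod' (f := fun xy => traceNorm (krausTerm K n (walkState ω) xy))]
    simp_rw [fun x => (traceNorm_of_hasSum (fun y => hpos (x, y))
      (hasSum_krausTerm_walkState_right hω K n x)).symm]
    rw [hstep.tsum_traceNorm_stateTerm]
    exact ENNReal.one_ne_top
  have hsum := (summable_of_tsum_traceNorm_ne_top htop).hasSum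
  -- The double sum, taken row by row, is the series of the next state; this identifies the
  -- operator-norm limit before positivity upgrades the convergence.
  have heq := (hsum.prod_fiberwise (hasSum_krausTerm_walkState_right hω K n)).unique
    hstep.hasTraceSum_stateTerm.hasSum
  rw [heq] at hsum
  exact hasTraceSum_of_isPositive hpos htop hsum

end Walk

end OpenQBN

end

theorem theorem2p9 (d : ℕ) (hd : 2 ≤ d) (p : ℕ → Set.Ioo (0 : ℝ) 1)
    (K : TensorPower (BernoulliL2 p) d ≃ₗᵢ[ℂ] BernoulliL2 p)
    (ω : ℕ → (Fin d → ℤ) → (BernoulliL2 p →L[ℂ] BernoulliL2 p))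
    (hω_init : IsNucleus (ω 0))
    (hω_step : ∀ n, ω (n + 1) = nucleusStep K n (ω n)) :
    (∀ n, IsNucleus (ω n) ∧ HasTraceSum (stateTerm (ω n)) (walkState (ω n)) ∧
      IsDensity (walkState (ω n))) ∧
    ∀ n, HasTraceSum (krausTerm K n (walkState (ω n))) (walkState (ω (n + 1))) ∧
      walkState (ω (n + 1)) = krausMap K n (walkState (ω n)) := by
  have hω : ∀ n, IsNucleus (ω n) := by
    intro n
    induction n with
    | zero => exact hω_init
    | succ n ih => rw [hω_step]; exact ih.nucleusStep K n
  refine ⟨fun n => ⟨hω n, (hω n).hasTraceSum_stateTerm, (hω n).isDensity_walkState⟩, fun n => ?_⟩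
  have h := hasTraceSum_krausTerm_walkState (hω n) K n
  rw [← hω_step] at h
  exact ⟨h, h.traceSum_eq.symm⟩
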